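/- Rings are associative with identity, not necessarily commutative, and modules are unital right modules. Let $M$ be a right $R$-module. A submodule $N$ of a module $D$ is \emph{essential} in $D$ if $N\cap K\neq 0$ for every nonzero submodule $K\leq D$. For $X\subseteq M$ put $r_R(X)=\{r\in R \mid xr=0 \text{ for all } x\in X\}$. The \emph{singular submodule} of $M$ is $Z(M)=\{m\in M \mid r_R(\{m\}) \text{ is essential in } R_R\}$; $M$ is \emph{nonsingular} if $Z(M)=0$, and $R$ is \emph{right nonsingular} if $R_R$ is nonsingular. A submodule $N\leq M$ is \emph{fully invariant} if $f(N)\subseteq N$ for every $f\in \mathrm{End}_R(M)$, and $M$ is \emph{FI-extending} if every fully invariant submodule of $M$ is essential in a direct summand of $M$. The ring $R$ is \emph{semiprime} if $aRa=0$ implies $a=0$; \emph{prime} if $R\neq 0$ and $aRb=0$ implies $a=0$ or $b=0$; \emph{quasi-Baer} (respectively \emph{Baer}) if for every two-sided ideal (respectively every subset) $X$ of $R$ there is an idempotent $e\in R$ with $r_R(X)=eR$. An \emph{$AW^*$-algebra} is a unital complex $C^*$-algebra which is a Baer ring. \textbf{Proposition.} If $R$ is a right nonsingular semiprime quasi-Baer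 ring, then every projective right $R$-module is nonsingular and FI-extending. Moreover, each of the following rings is right nonsingular, semiprime and quasi-Baer: right nonsingular prime rings, commutative Baer rings, and $AW^*$-algebras. -/

import Mathlib

open MulOpposite

/-! A right module over `R` is a module over `Rᵐᵒᵖ`; the action `m * r` is `op r • m`, and the
right ideals of `R` are the `Rᵐᵒᵖ`-submodules of `R`. -/

namespace RightModule

section Lattice

variable {S M : Type*} [Ring S] [AddCommGroup M] [Module S M]

/-- `N` is an essential submodule of the submodule `D`: it is contained in `D` and meets every
nonzero submodule of `D` nontrivially. -/
def IsEssentialIn (N D : Submodule S M) : Prop :=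
  N ≤ D ∧ ∀ K : Submodule S M, K ≤ D → K ≠ ⊥ → N ⊓ K ≠ ⊥

/-- `D` is a direct summand of the ambient module. -/
def IsDirectSummand (D : Submodule S M) : Prop :=
  ∃ D' : Submodule S M, IsCompl D D'

variable (S M) in
/-- Every fully invariant submodule is essential in a direct summand. -/
def IsFIExtending : Prop :=
  ∀ N : Submodule S M, N.IsFullyInvariant →
    ∃ D : Submodule S M, IsDirectSummand D ∧ IsEssentialIn N D

end Lattice

section Annihilator

variable (R : Type*) {M : Type*} [Ring R] [AddCommGroup M] [Module Rᵐᵒᵖ M]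

/-- The right annihilator `{r ∈ R | n r = 0 for all n ∈ X}` of a subset `X` of a right `R`-module,
as a right ideal of `R`. -/
def rightAnnihilator (X : Set M) : Submodule Rᵐᵒᵖ R where
  carrier := {r | ∀ n ∈ X, op r • n = 0}
  zero_mem' := by
    intro n _
    simp
  add_mem' := by
    intro a b ha hb n hn
    rw [op_add, add_smul, ha n hn, hb n hn, add_zero]
  smul_mem' := by
    intro c x hx n hn
    have h : op (c • x) = c * op x := by
      rw [← op_unop c, op_smul_eq_mul, op_mul]
    rw [h, mul_smul, hx n hn, smul_zero]

variable {R} in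
theorem mem_rightAnnihilator {X : Set M} {r : R} :
    r ∈ rightAnnihilator R X ↔ ∀ n ∈ X, op r • n = 0 := Iff.rfl

variable (M) in
/-- The singular submodule `Z(M)` of a right `R`-module `M`: the elements whose right annihilator
is an essential right ideal of `R`. -/
def singularSubmodule : Submodule Rᵐᵒᵖ M where
  carrier := {m | IsEssentialIn (rightAnnihilator R {m}) ⊤}
  zero_mem' := by
    refine ⟨le_top, fun K _ hK => ?_⟩
    have h : rightAnnihilator R {(0 : M)} = ⊤ := by
      rw [eq_top_iff]
      intro r _
      simp [mem_rightAnnihilator]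
    rwa [h, top_inf_eq]
  add_mem' := by
    intro a b ha hb
    refine ⟨le_top, fun K _ hK => ?_⟩
    have h := ha.2 _ le_top (hb.2 K le_top hK)
    refine ne_bot_of_le_ne_bot h ?_
    rintro x ⟨hxa, hxb, hxK⟩
    refine ⟨?_, hxK⟩
    intro n hn
    rw [Set.mem_singleton_iff] at hn
    rw [hn, smul_add, hxa a rfl, hxb b rfl, add_zero]
  smul_mem' := by
    intro c m hm
    refine ⟨le_top, fun K _ hK => ?_⟩
    by_cases h0 : ∀ k ∈ K, unop c * k = 0
    · refine ne_bot_of_le_ne_bot hK ?_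
      intro k hk
      refine ⟨?_, hk⟩
      intro n hn
      rw [Set.mem_singleton_iff] at hn
      have h : op k * c = 0 := by
        rw [← op_unop c, ← op_mul, h0 k hk, op_zero]
      rw [hn, ← mul_smul, h, zero_smul]
    · push Not at h0
      obtain ⟨k, hk, hk0⟩ := h0
      let f : R →ₗ[Rᵐᵒᵖ] R :=
        { toFun := fun x => unop c * x
          map_add' := fun x y => mul_add _ x y
          map_smul' := fun s x => (mul_assoc (unop c) x (unop s)).symm }
      have hne : Submodule.map f K ≠ ⊥ := by
        intro h
        have h1 : f k ∈ Submodule.map f K := Submodule.mem_map_of_mem hk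
        rw [h] at h1
        exact hk0 ((Submodule.mem_bot _).1 h1)
      obtain ⟨y, ⟨hy, x, hx, hxy⟩, hy0⟩ :=
        Submodule.exists_mem_ne_zero_of_ne_bot (hm.2 _ le_top hne)
      have hxy' : unop c * x = y := hxy
      refine (Submodule.ne_bot_iff _).2 ⟨x, ⟨?_, hx⟩, ?_⟩
      · intro n hn
        rw [Set.mem_singleton_iff] at hn
        have h : op x * c = op y := by
          rw [← hxy', op_mul, op_unop]
        rw [hn, ← mul_smul, h]
        exact hy m rfl
      · rintro rfl
        exact hy0 (by rw [← hxy', mul_zero])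

variable (M) in
/-- A right module is nonsingular if its singular submodule is zero. -/
def IsNonsingular : Prop := singularSubmodule R M = ⊥

/-- `R` is right nonsingular: the right module `R` is nonsingular. -/
def IsRightNonsingularRing : Prop := IsNonsingular R R

/-- `R` is semiprime: `a R a = 0` implies `a = 0`. -/
def IsSemiprimeRing : Prop :=
  ∀ a : R, (∀ r : R, a * r * a = 0) → a = 0

/-- `R` is prime: it is nonzero, and `a R b = 0` implies `a = 0` or `b = 0`. -/
def IsPrimeRing : Prop :=
  Nontrivial R ∧ ∀ a b : R, (∀ r : R, a * r * b = 0) → a = 0 ∨ b = 0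

/-- `R` is quasi-Baer: the right annihilator of every two-sided ideal is the right ideal
generated by an idempotent. -/
def IsQuasiBaerRing : Prop :=
  ∀ I : TwoSidedIdeal R, ∃ e : R, IsIdempotentElem e ∧
    rightAnnihilator R (I : Set R) = Submodule.span Rᵐᵒᵖ {e}

/-- `R` is Baer: the right annihilator of every subset is the right ideal generated by an
idempotent. -/
def IsBaerRing : Prop :=
  ∀ X : Set R, ∃ e : R, IsIdempotentElem e ∧
    rightAnnihilator R X = Submodule.span Rᵐᵒᵖ {e}

end Annihilator

/-- A (unital) C⋆-algebra is an AW⋆-algebra if it is a Baer ring. -/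
def IsAWStarAlgebra (A : Type*) [CStarAlgebra A] : Prop := IsBaerRing A

end RightModule

/-! Call a module torsionless if its linear functionals separate points; projective modules are
torsionless. Functionals preserve singular elements, so a torsionless module over a right
nonsingular ring is nonsingular.

Let `N` be fully invariant in a torsionless right module `M`, and let `I = {r ∈ R | M r ⊆ N}`. For a
functional `φ` and `p ∈ M` the endomorphism `m ↦ p φ(m)` preserves `N`, so `φ(N) ⊆ I`. If `R` is
semiprime and quasi-Baer, the annihilator of `I` is generated by a central idempotent `e`. Testing
on functionals gives `N e = 0` and shows that every element of `M` killed by `I` is fixed by `e`.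
Hence a submodule `K` of the direct summand `{m | m e = 0}` with `N ∩ K = 0` satisfies
`K I ⊆ N ∩ K = 0`, so that `K = K e = 0`.

In a Baer ring the annihilator of an element `x` is a direct summand, so if it is essential it is
all of `R` and `x = 0`. -/

namespace RightModule

section Summand

variable {S M : Type*} [Ring S] [AddCommGroup M] [Module S M] {N N' D : Submodule S M}

theorem IsEssentialIn.mono (h : IsEssentialIn N D) (hNN' : N ≤ N') (hN'D : N' ≤ D) :
    IsEssentialIn N' D :=
  ⟨hN'D, fun K hKD hK => ne_bot_of_le_ne_bot (h.2 K hKD hK) (inf_le_inf_right K hNN')⟩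

theorem IsEssentialIn.eq_top_of_isDirectSummand (h : IsEssentialIn N ⊤) (hN : IsDirectSummand N) :
    N = ⊤ := by
  obtain ⟨N', hNN'⟩ := hN
  have hN' : N' = ⊥ := not_not.1 fun hne => h.2 N' le_top hne hNN'.inf_eq_bot
  exact eq_top_of_isCompl_bot (hN' ▸ hNN')

theorem isDirectSummand_ker_smulLeft {e : S} (he : IsIdempotentElem e)
    (hcenter : e ∈ Set.center S) :
    IsDirectSummand (Module.End.smulLeft e hcenter : Module.End S M).ker := by
  have hidem : IsIdempotentElem (Module.End.smulLeft e hcenter : Module.End S M) :=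
    LinearMap.ext fun m => by
      rw [Module.End.mul_apply, Module.End.smulLeft_apply, Module.End.smulLeft_apply, smul_smul,
        he.eq]
  exact ⟨_, (LinearMap.IsIdempotentElem.isCompl hidem).symm⟩

end Summand

section Torsionless

variable {S M : Type*} [Ring S] [AddCommGroup M] [Module S M]

variable (S M) in
/-- A module is torsionless if its linear functionals separate points, that is, if it embeds into a
product of copies of the base ring. -/
def IsTorsionless : Prop :=
  ∀ m : M, (∀ φ : Module.Dual S M, φ m = 0) → m = 0

theorem isTorsionless_of_projective [Module.Projective S M] : IsTorsionless S M :=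
  fun m => (Module.forall_dual_apply_eq_zero_iff S m).1

theorem dual_apply_mem_colon {N : Submodule S M} (hN : N.IsFullyInvariant) (φ : Module.Dual S M)
    {n : M} (hn : n ∈ N) : φ n ∈ N.colon (⊤ : Submodule S M) :=
  Submodule.mem_colon.2 fun p _ => hN (φ.smulRight p) hn

theorem IsTorsionless.smul_eq_zero_of_mem (hM : IsTorsionless S M) {N : Submodule S M}
    (hN : N.IsFullyInvariant) {c : S} (hc : ∀ a ∈ N.colon (⊤ : Submodule S M), c * a = 0)
    {n : M} (hn : n ∈ N) : c • n = 0 :=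
  hM _ fun φ => by rw [map_smul, smul_eq_mul, hc _ (dual_apply_mem_colon hN φ hn)]

theorem IsTorsionless.smul_eq_self (hM : IsTorsionless S M) {I : Set S} {e : S}
    (he : ∀ x, (∀ a ∈ I, a * x = 0) → e * x = x) {m : M} (hm : ∀ a ∈ I, a • m = 0) :
    e • m = m := by
  refine sub_eq_zero.1 (hM _ fun φ => ?_)
  have hφ : e * φ m = φ m :=
    he _ fun a ha => by rw [← smul_eq_mul, ← map_smul, hm a ha, map_zero]
  rw [map_sub, map_smul, smul_eq_mul, hφ, sub_self]

theorem smul_eq_zero_of_mem_colon_of_inf_eq_bot {N K : Submodule S M} (hNK : N ⊓ K = ⊥) {a : S}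
    (ha : a ∈ N.colon (⊤ : Submodule S M)) {k : M} (hk : k ∈ K) : a • k = 0 := by
  have hak : a • k ∈ N ⊓ K := ⟨Submodule.mem_colon.1 ha k trivial, K.smul_mem a hk⟩
  rwa [hNK, Submodule.mem_bot] at hak

theorem IsTorsionless.isEssentialIn_ker_smulLeft (hM : IsTorsionless S M) {N : Submodule S M}
    (hN : N.IsFullyInvariant) {e : S} (he : IsIdempotentElem e) (hcenter : e ∈ Set.center S)
    (hann : ∀ x, e * x = x ↔ ∀ a ∈ N.colon (⊤ : Submodule S M), a * x = 0) :
    IsEssentialIn N (Module.End.smulLeft e hcenter : Module.End S M).ker := by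
  refine ⟨fun n hn => ?_, fun K hK hK0 hNK => hK0 ((Submodule.eq_bot_iff K).2 fun k hk => ?_)⟩
  · refine hM.smul_eq_zero_of_mem hN (fun a ha => ?_) hn
    rw [← Semigroup.mem_center_iff.1 hcenter a, (hann e).1 he.eq a ha]
  · have hek : e • k = k := hM.smul_eq_self (fun x => (hann x).2) fun a ha =>
      smul_eq_zero_of_mem_colon_of_inf_eq_bot hNK ha hk
    exact hek.symm.trans (hK hk)

end Torsionless

section Singular

variable {R M M' : Type*} [Ring R] [AddCommGroup M] [Module Rᵐᵒᵖ M] [AddCommGroup M']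
  [Module Rᵐᵒᵖ M']

theorem map_mem_singularSubmodule (f : M →ₗ[Rᵐᵒᵖ] M') {m : M} (hm : m ∈ singularSubmodule R M) :
    f m ∈ singularSubmodule R M' := by
  refine IsEssentialIn.mono hm ?_ le_top
  rintro r hr _ rfl
  rw [← map_smul, hr m rfl, map_zero]

theorem IsTorsionless.isNonsingular (hM : IsTorsionless Rᵐᵒᵖ M) (hR : IsRightNonsingularRing R) :
    IsNonsingular R M := by
  refine (Submodule.eq_bot_iff _).2 fun m hm => hM m fun φ => ?_
  have hφ : unop (φ m) ∈ singularSubmodule R R :=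
    map_mem_singularSubmodule ((opLinearEquiv Rᵐᵒᵖ).symm.toLinearMap ∘ₗ φ) hm
  rwa [show singularSubmodule R R = ⊥ from hR, Submodule.mem_bot, unop_eq_zero_iff] at hφ

end Singular

section Idempotent

variable {R : Type*} [Ring R]

theorem mem_span_singleton_iff_of_isIdempotentElem {e r : R} (he : IsIdempotentElem e) :
    r ∈ Submodule.span Rᵐᵒᵖ {e} ↔ e * r = r := by
  rw [Submodule.mem_span_singleton]
  constructor
  · rintro ⟨a, rfl⟩
    rw [← op_unop a, op_smul_eq_mul, ← mul_assoc, he.eq]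
  · exact fun h => ⟨op r, h⟩

theorem rightAnnihilator_eq_span_singleton_iff {X : Set R} {e : R} (he : IsIdempotentElem e) :
    rightAnnihilator R X = Submodule.span Rᵐᵒᵖ {e} ↔ ∀ r, (∀ x ∈ X, x * r = 0) ↔ e * r = r := by
  simp only [SetLike.ext_iff, mem_span_singleton_iff_of_isIdempotentElem he]
  rfl

theorem isDirectSummand_span_singleton_of_isIdempotentElem {e : R} (he : IsIdempotentElem e) :
    IsDirectSummand (Submodule.span Rᵐᵒᵖ {e}) := by
  have hf : IsIdempotentElem (LinearMap.mulLeft Rᵐᵒᵖ e) := LinearMap.ext fun r => by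
    simp [← mul_assoc, he.eq]
  have hrange : (LinearMap.mulLeft Rᵐᵒᵖ e).range = Submodule.span Rᵐᵒᵖ {e} :=
    Submodule.ext fun r => by
      rw [LinearMap.IsIdempotentElem.mem_range_iff hf,
        mem_span_singleton_iff_of_isIdempotentElem he, LinearMap.mulLeft_apply]
  exact ⟨_, hrange ▸ LinearMap.IsIdempotentElem.isCompl hf⟩

end Idempotent

section Semiprime

variable {R : Type*} [Ring R]

theorem IsSemiprimeRing.forall_mul_eq_zero_comm (hR : IsSemiprimeRing R) (I : TwoSidedIdeal R)
    {x : R} : (∀ a ∈ I, x * a = 0) ↔ ∀ a ∈ I, a * x = 0 := by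
  constructor <;> intro h a ha <;> refine hR _ fun r => ?_
  · calc a * x * r * (a * x) = a * (x * (r * a)) * x := by simp only [mul_assoc]
      _ = 0 := by rw [h _ (I.mul_mem_left r a ha), mul_zero, zero_mul]
  · calc x * a * r * (x * a) = x * (a * r * x) * a := by simp only [mul_assoc]
      _ = 0 := by rw [h _ (I.mul_mem_right a r ha), mul_zero, zero_mul]

theorem IsSemiprimeRing.mem_center_of_mul_mul_eq (hR : IsSemiprimeRing R) {e : R}
    (he : ∀ r, e * (r * e) = r * e) : e ∈ Set.center R := by
  refine Semigroup.mem_center_iff.2 fun r => ?_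
  have hr : e * r * (1 - e) = 0 := hR _ fun s => by
    have hs : (1 - e) * (s * e) = 0 := by rw [sub_mul, one_mul, he, sub_self]
    calc e * r * (1 - e) * s * (e * r * (1 - e))
        = e * r * ((1 - e) * (s * e)) * (r * (1 - e)) := by simp only [mul_assoc]
      _ = 0 := by rw [hs, mul_zero, zero_mul]
  rw [mul_sub, mul_one, sub_eq_zero, mul_assoc, he] at hr
  exact hr.symm

theorem IsSemiprimeRing.exists_central_idempotent (hR : IsSemiprimeRing R)
    (hQ : IsQuasiBaerRing R) (I : TwoSidedIdeal R) :
    ∃ e : R, IsIdempotentElem e ∧ e ∈ Set.center R ∧ ∀ x, x * e = x ↔ ∀ a ∈ I, x * a = 0 := by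
  obtain ⟨e, he, hI⟩ := hQ I
  have hann : ∀ x, (∀ a ∈ I, a * x = 0) ↔ e * x = x :=
    (rightAnnihilator_eq_span_singleton_iff he).1 hI
  have hcenter : e ∈ Set.center R := hR.mem_center_of_mul_mul_eq fun r =>
    (hann _).1 fun a ha => by
      rw [← mul_assoc, (hann e).2 he.eq _ (I.mul_mem_right a r ha)]
  refine ⟨e, he, hcenter, fun x => ?_⟩
  rw [hR.forall_mul_eq_zero_comm I, hann, Semigroup.mem_center_iff.1 hcenter x]

theorem IsTorsionless.isFIExtending {M : Type*} [AddCommGroup M] [Module Rᵐᵒᵖ M]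
    (hM : IsTorsionless Rᵐᵒᵖ M) (hR : IsSemiprimeRing R) (hQ : IsQuasiBaerRing R) :
    IsFIExtending Rᵐᵒᵖ M := by
  intro N hN
  obtain ⟨e, he, hcenter, hann⟩ :=
    hR.exists_central_idempotent hQ (N.colon (⊤ : Submodule Rᵐᵒᵖ M)).toTwoSided.unop
  have hcenter' : op e ∈ Set.center Rᵐᵒᵖ := op_mem_center_iff.2 hcenter
  have he' : IsIdempotentElem (op e) := congrArg op he
  have hann' (x : Rᵐᵒᵖ) :
      op e * x = x ↔ ∀ a ∈ N.colon (⊤ : Submodule Rᵐᵒᵖ M), a * x = 0 := by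
    simpa [← unop_inj, op_surjective.forall, TwoSidedIdeal.mem_unop_iff] using hann (unop x)
  exact ⟨_, isDirectSummand_ker_smulLeft he' hcenter',
    hM.isEssentialIn_ker_smulLeft hN he' hcenter' hann'⟩

end Semiprime

section Prime

variable {R : Type*} [Ring R]

theorem IsPrimeRing.isSemiprimeRing (hR : IsPrimeRing R) : IsSemiprimeRing R :=
  fun a ha => or_self_iff.1 (hR.2 a a ha)

theorem IsPrimeRing.isQuasiBaerRing (hR : IsPrimeRing R) : IsQuasiBaerRing R := by
  intro I
  by_cases hI : ∀ a ∈ I, a = 0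
  · refine ⟨1, .one, (rightAnnihilator_eq_span_singleton_iff .one).2 fun r => ?_⟩
    exact iff_of_true (fun a ha => by rw [hI a ha, zero_mul]) (one_mul r)
  · push Not at hI
    obtain ⟨a, ha, ha0⟩ := hI
    refine ⟨0, .zero, (rightAnnihilator_eq_span_singleton_iff .zero).2 fun r => ?_⟩
    rw [zero_mul]
    refine ⟨fun hr => ?_, fun hr b _ => by rw [← hr, mul_zero]⟩
    exact ((hR.2 a r fun s => hr _ (I.mul_mem_right a s ha)).resolve_left ha0).symm

end Prime

section Baer

variable {R : Type*} [Ring R]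

theorem IsBaerRing.isQuasiBaerRing (hR : IsBaerRing R) : IsQuasiBaerRing R :=
  fun I => hR I

theorem IsBaerRing.isRightNonsingularRing (hR : IsBaerRing R) : IsRightNonsingularRing R := by
  refine (Submodule.eq_bot_iff _).2 fun x (hx : IsEssentialIn (rightAnnihilator R {x}) ⊤) => ?_
  obtain ⟨e, he, hxe⟩ := hR {x}
  have htop : rightAnnihilator R {x} = ⊤ :=
    hx.eq_top_of_isDirectSummand (hxe ▸ isDirectSummand_span_singleton_of_isIdempotentElem he)
  have hone : (1 : R) ∈ rightAnnihilator R {x} := htop ▸ Submodule.mem_top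
  simpa [mem_rightAnnihilator] using hone

theorem IsBaerRing.isSemiprimeRing_of_idempotents_central (hR : IsBaerRing R)
    (hcenter : ∀ e : R, IsIdempotentElem e → e ∈ Set.center R) : IsSemiprimeRing R := by
  intro a ha
  obtain ⟨e, he, hae⟩ := hR {a}
  have hann (r : R) : a * r = 0 ↔ e * r = r := by
    simpa using (rightAnnihilator_eq_span_singleton_iff he).1 hae r
  have haa : a * a = 0 := by simpa using ha 1
  calc a = e * a := ((hann a).1 haa).symm
    _ = a * e := (Semigroup.mem_center_iff.1 (hcenter e he) a).symm
    _ = 0 := (hann e).2 he.eq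

theorem isSemiprimeRing_of_star_mul_self_eq_zero [StarMul R]
    (hR : ∀ a : R, star a * a = 0 → a = 0) : IsSemiprimeRing R := by
  intro a ha
  refine hR a (hR _ ?_)
  calc star (star a * a) * (star a * a) = star a * (a * star a * a) := by
        simp only [star_mul, star_star, mul_assoc]
    _ = 0 := by rw [ha, mul_zero]

end Baer

end RightModule

open RightModule in
theorem mainTheorem9_general :
    (∀ (R : Type*) [Ring R], IsRightNonsingularRing R →
      ∀ (M : Type*) [AddCommGroup M] [Module Rᵐᵒᵖ M], IsTorsionless Rᵐᵒᵖ M →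
        IsNonsingular R M) ∧
    (∀ (R : Type*) [Ring R], IsSemiprimeRing R → IsQuasiBaerRing R →
      ∀ (M : Type*) [AddCommGroup M] [Module Rᵐᵒᵖ M], IsTorsionless Rᵐᵒᵖ M →
        IsFIExtending Rᵐᵒᵖ M) ∧
    (∀ (R : Type*) [Ring R], IsPrimeRing R → IsSemiprimeRing R ∧ IsQuasiBaerRing R) ∧
    (∀ (R : Type*) [Ring R], (∀ e : R, IsIdempotentElem e → e ∈ Set.center R) → IsBaerRing R →
      IsRightNonsingularRing R ∧ IsSemiprimeRing R ∧ IsQuasiBaerRing R) ∧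
    (∀ (R : Type*) [Ring R] [StarMul R], (∀ a : R, star a * a = 0 → a = 0) → IsBaerRing R →
      IsRightNonsingularRing R ∧ IsSemiprimeRing R ∧ IsQuasiBaerRing R) :=
  ⟨fun _ _ hN _ _ _ hM => hM.isNonsingular hN,
    fun _ _ hS hQ _ _ _ hM => hM.isFIExtending hS hQ,
    fun _ _ hP => ⟨hP.isSemiprimeRing, hP.isQuasiBaerRing⟩,
    fun _ _ hcenter hB => ⟨hB.isRightNonsingularRing,
      hB.isSemiprimeRing_of_idempotents_central hcenter, hB.isQuasiBaerRing⟩,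
    fun _ _ _ hstar hB => ⟨hB.isRightNonsingularRing,
      isSemiprimeRing_of_star_mul_self_eq_zero hstar, hB.isQuasiBaerRing⟩⟩

theorem mainTheorem9 :
    (∀ (R : Type*) [Ring R],
      RightModule.IsRightNonsingularRing R → RightModule.IsSemiprimeRing R →
      RightModule.IsQuasiBaerRing R →
      ∀ (M : Type*) [AddCommGroup M] [Module Rᵐᵒᵖ M], Module.Projective Rᵐᵒᵖ M →
        RightModule.IsNonsingular R M ∧ RightModule.IsFIExtending Rᵐᵒᵖ M) ∧
    (∀ (R : Type*) [Ring R],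
      RightModule.IsPrimeRing R → RightModule.IsRightNonsingularRing R →
      RightModule.IsSemiprimeRing R ∧ RightModule.IsQuasiBaerRing R) ∧
    (∀ (R : Type*) [CommRing R],
      RightModule.IsBaerRing R →
      RightModule.IsRightNonsingularRing R ∧ RightModule.IsSemiprimeRing R ∧
        RightModule.IsQuasiBaerRing R) ∧
    (∀ (A : Type*) [CStarAlgebra A],
      RightModule.IsAWStarAlgebra A →
      RightModule.IsRightNonsingularRing A ∧ RightModule.IsSemiprimeRing A ∧
        RightModule.IsQuasiBaerRing A) := by
  obtain ⟨hN, hF, hP, hC, hS⟩ := mainTheorem9_general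
  exact ⟨fun R _ hRN hRS hRQ M _ _ _ =>
      ⟨hN R hRN M RightModule.isTorsionless_of_projective,
        hF R hRS hRQ M RightModule.isTorsionless_of_projective⟩,
    fun R _ hRP _ => hP R hRP,
    fun R _ => hC R fun e _ => Set.center_eq_univ R ▸ Set.mem_univ e,
    fun A _ => hS A fun a => (CStarRing.star_mul_self_eq_zero_iff a).1⟩
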